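/- **Lemma 1.4.** Let $p$ be a prime, $K$ a complete extension field of $\mathbb{Q}_p$ (with an absolute value extending that of $\mathbb{Q}_p$) and $L\subseteq K$ a finite extension of $\mathbb{Q}_p$. Let $G$ be a (totally disconnected, locally compact) locally $L$-analytic group, i.e. a finite dimensional $L$-analytic Lie group, with Lie algebra $\mathfrak{g}$, and let $U\subseteq G$ be a compact open subgroup. Let $\rho$ be a locally $L$-analytic representation of $G$ on a finite dimensional $K$-vector space $E$, i.e. a $K$-linear representation such that all orbit maps $g\mapsto\rho(g)v$, $v\in E$, are locally $L$-analytic. For a representation $\sigma$ of $U$ on a finite dimensional $K$-vector space $W$ let $\mathcal{H}(G,\sigma)$ be the $K$-vector space of all compactly supported functions $\psi:G\to\mathrm{End}_K(W)$ such that $\psi(u_1gu_2)=\sigma(u_1)\circ\psi(g)\circ\sigma(u_2)$ for all $u_1,u_2\in U$ and $g\in G$. It is a unital associative $K$-algebra under the convolution $(\psi_1*\psi_2)(h)=\sum_{g\in G/U}\psi_1(g)\circ\psi_2(g^{-1}h)$, with unit the extension of $\sigma$ by zero to $G$. Write $\mathcal{H}(G,1_U)$ for the case of the trivial representation of $U$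 on $K$, so that its elements are $K$-valued functions, and $\mathcal{H}(G,\rho)$ for the case $\sigma=\rho|_U$. The Lie algebra $\mathfrak{g}$ acts on $E$ by the derived action: $X\in\mathfrak{g}=T_1G$ sends $v$ to the derivative at $1$, in the direction $X$, of the orbit map $g\mapsto\rho(g)v$. Suppose that the $K\otimes_L\mathfrak{g}$-module $E$ is absolutely irreducible, i.e. that for every extension field $K'$ of $K$ the $K'\otimes_L\mathfrak{g}$-module $K'\otimes_K E$ is irreducible (non-zero, without stable $K'$-subspaces other than $0$ and itself). Then $$\iota_\rho:\ \mathcal{H}(G,1_U)\longrightarrow\mathcal{H}(G,\rho),\qquad \psi\longmapsto\psi\cdot\rho,\qquad (\psi\cdot\rho)(g)=\psi(g)\,\rho(g),$$ is (well defined and) an isomorphism of $K$-algebras. -/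

import Mathlib

open scoped Manifold ContDiff TensorProduct

set_option linter.unusedSectionVars false

namespace BanachHecke

/-! ### The Hecke algebra of a representation of a compact open subgroup -/

section Hecke

/-- `U` is a compact open subgroup of the topological group `G`. -/
class IsCompactOpen {G : Type*} [Group G] [TopologicalSpace G] (U : Subgroup G) : Prop where
  isOpen : IsOpen (U : Set G)
  isCompact : IsCompact (U : Set G)

variable {G : Type*} [Group G] [TopologicalSpace G]
variable {K : Type*} [Field K] {W : Type*} [AddCommGroup W] [Module K W]

/-- The underlying `K`-vector space of the Hecke algebra `H(G, ρ)`: all compactly supported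
functions `ψ : G → End_K(W)` with `ψ(u₁ g u₂) = ρ(u₁) ∘ ψ(g) ∘ ρ(u₂)`. -/
def heckeModule (U : Subgroup G) (ρ : Representation K U W) :
    Submodule K (G → Module.End K W) where
  carrier := {ψ | HasCompactSupport ψ ∧
    ∀ (u₁ u₂ : U) (g : G), ψ (u₁ * g * u₂) = ρ u₁ ∘ₗ ψ g ∘ₗ ρ u₂}
  zero_mem' := ⟨HasCompactSupport.zero, fun u₁ u₂ g => by simp⟩
  add_mem' := by
    rintro a b ⟨ha, ha'⟩ ⟨hb, hb'⟩
    refine ⟨ha.add hb, fun u₁ u₂ g => ?_⟩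
    simp [ha', hb', LinearMap.add_comp, LinearMap.comp_add]
  smul_mem' := by
    rintro c a ⟨ha, ha'⟩
    refine ⟨ha.mono fun x hx h => hx (by simp [h]), fun u₁ u₂ g => ?_⟩
    simp [ha', LinearMap.smul_comp, LinearMap.comp_smul]

/-- The Hecke algebra `H(G, ρ)`. -/
abbrev HeckeAlgebra (U : Subgroup G) (ρ : Representation K U W) : Type _ :=
  ↥(heckeModule U ρ)

/-- The convolution `(ψ₁ * ψ₂)(h) = ∑_{g ∈ G/U} ψ₁(g) ∘ ψ₂(g⁻¹ h)` of two functions. On the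
Hecke algebra the summand depends only on the coset `gU` (see `summand_right_inv`), and the sum
has only finitely many non-zero terms (see `finite_support`). -/
noncomputable def convolution (U : Subgroup G) (ψ₁ ψ₂ : G → Module.End K W) (h : G) :
    Module.End K W :=
  ∑ᶠ x : G ⧸ U, ψ₁ x.out ∘ₗ ψ₂ (x.out⁻¹ * h)

open Classical in
/-- The unit of the Hecke algebra: `ρ` extended by zero from `U` to `G`. -/
noncomputable def unitFun (U : Subgroup G) (ρ : Representation K U W) (h : G) :
    Module.End K W :=
  if hh : h ∈ U then ρ ⟨h, hh⟩ else 0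

variable {U : Subgroup G} {ρ : Representation K U W}

theorem left_equivariant {ψ : G → Module.End K W} (hψ : ψ ∈ heckeModule U ρ) (u : U) (g : G) :
    ψ (u * g) = ρ u * ψ g := by
  have := hψ.2 u 1 g
  simpa [Module.End.mul_eq_comp, Module.End.one_eq_id] using this

theorem right_equivariant {ψ : G → Module.End K W} (hψ : ψ ∈ heckeModule U ρ) (u : U) (g : G) :
    ψ (g * u) = ψ g * ρ u := by
  have := hψ.2 1 u g
  simpa [Module.End.mul_eq_comp, Module.End.one_eq_id] using this

/-- The summand of the convolution depends only on the coset. -/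
theorem summand_right_inv {a b : G → Module.End K W} (ha : a ∈ heckeModule U ρ)
    (hb : b ∈ heckeModule U ρ) (h g : G) (u : U) :
    a (g * u) * b ((g * u)⁻¹ * h) = a g * b (g⁻¹ * h) := by
  have h1 : (g * (u : G))⁻¹ * h = ((u⁻¹ : U) : G) * (g⁻¹ * h) := by simp [mul_assoc]
  rw [h1, right_equivariant ha, left_equivariant hb, mul_assoc, ← mul_assoc (ρ u), ← map_mul]
  simp

theorem out_eq {M : Type*} {F : G → M} (hF : ∀ (g : G) (u : U), F (g * u) = F g) (g : G) :
    F (g : G ⧸ U).out = F g := by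
  obtain ⟨u, hu⟩ := QuotientGroup.mk_out_eq_mul U g
  rw [hu, hF]

theorem finsum_translate {M : Type*} [AddCommMonoid M] {F : G → M}
    (hF : ∀ (g : G) (u : U), F (g * u) = F g) (g : G) :
    ∑ᶠ x : G ⧸ U, F (g * x.out) = ∑ᶠ x : G ⧸ U, F x.out := by
  rw [← finsum_comp_equiv (MulAction.toPerm (α := G) (β := G ⧸ U) g)
    (f := fun x : G ⧸ U => F x.out)]
  refine finsum_congr fun x => ?_
  have : MulAction.toPerm g x = ((g * x.out : G) : G ⧸ U) := by
    conv_lhs => rw [← QuotientGroup.out_eq' x]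
    rfl
  rw [this]
  exact (out_eq hF (g * x.out)).symm

theorem unitFun_apply (u : U) : unitFun U ρ u = ρ u := by
  simp [unitFun]

variable [IsTopologicalGroup G] [IsCompactOpen U]

theorem finite_out {a : G → Module.End K W} (ha : a ∈ heckeModule U ρ) :
    {x : G ⧸ U | a x.out ≠ 0}.Finite := by
  have : DiscreteTopology (G ⧸ U) :=
    QuotientGroup.discreteTopology (IsCompactOpen.isOpen (U := U))
  have h := (ha.1.isCompact.image (QuotientGroup.continuous_mk (N := U))).finite_of_discrete
  refine h.subset fun x hx => ⟨x.out, subset_tsupport _ hx, QuotientGroup.out_eq' x⟩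

/-- Only finitely many terms of the convolution are non-zero. -/
theorem finite_support {a : G → Module.End K W} (ha : a ∈ heckeModule U ρ)
    (c : G ⧸ U → Module.End K W) :
    (Function.support fun x : G ⧸ U => a x.out * c x).Finite := by
  refine (finite_out ha).subset fun x hx h => hx ?_
  simp [h]

theorem convolution_mem {a b : G → Module.End K W} (ha : a ∈ heckeModule U ρ)
    (hb : b ∈ heckeModule U ρ) : convolution U a b ∈ heckeModule U ρ := by
  constructor
  · refine HasCompactSupport.intro' (ha.1.isCompact.mul hb.1.isCompact).closure
      isClosed_closure fun h hh => ?_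
    refine finsum_eq_zero_of_forall_eq_zero fun x => ?_
    by_contra hne
    refine hh (subset_closure ⟨x.out, ?_, x.out⁻¹ * h, ?_, by simp⟩)
    · exact subset_tsupport _ fun h0 => hne (by simp [h0])
    · exact subset_tsupport _ fun h0 => hne (by simp [h0])
  · intro u₁ u₂ h
    change ∑ᶠ x : G ⧸ U, a x.out * b (x.out⁻¹ * (u₁ * h * u₂)) =
      ρ u₁ * ((∑ᶠ x : G ⧸ U, a x.out * b (x.out⁻¹ * h)) * ρ u₂)
    rw [finsum_mul' _ _ (finite_support ha _), mul_finsum' _ _ (by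
      simp_rw [mul_assoc]
      refine (finite_out ha).subset fun x hx h => hx ?_
      simp [h])]
    have hF := summand_right_inv ha hb ((u₁ : G) * h * u₂)
    rw [← finsum_translate (F := fun g => a g * b (g⁻¹ * (u₁ * h * u₂))) hF (u₁ : G)]
    refine finsum_congr fun x => ?_
    rw [left_equivariant ha]
    have : ((u₁ : G) * x.out)⁻¹ * (u₁ * h * u₂) = x.out⁻¹ * h * u₂ := by group
    rw [this, right_equivariant hb]
    simp only [mul_assoc]

theorem unitFun_mem : unitFun U ρ ∈ heckeModule U ρ := by
  constructor
  · have hc := IsCompactOpen.isCompact (U := U)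
    refine HasCompactSupport.intro' hc.closure isClosed_closure fun h hh => ?_
    have : h ∉ U := fun h' => hh (subset_closure h')
    simp [unitFun, this]
  · intro u₁ u₂ g
    by_cases hg : g ∈ U
    · have := unitFun_apply (ρ := ρ) (u₁ * ⟨g, hg⟩ * u₂)
      simp only [Subgroup.coe_mul] at this
      rw [this, map_mul, map_mul, mul_assoc]
      simp [unitFun, hg, Module.End.mul_eq_comp]
    · have : (u₁ : G) * g * u₂ ∉ U := by
        rw [Subgroup.mul_mem_cancel_right _ u₂.2, Subgroup.mul_mem_cancel_left _ u₁.2]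
        exact hg
      simp [unitFun, hg, this]

theorem unit_convolution {b : G → Module.End K W} (hb : b ∈ heckeModule U ρ) :
    convolution U (unitFun U ρ) b = b := by
  funext h
  have hF := summand_right_inv (unitFun_mem (U := U) (ρ := ρ)) hb h
  change ∑ᶠ x : G ⧸ U, unitFun U ρ x.out * b (x.out⁻¹ * h) = b h
  rw [finsum_eq_single _ ((1 : G) : G ⧸ U)]
  · rw [out_eq (F := fun g => unitFun U ρ g * b (g⁻¹ * h)) hF 1]
    have := unitFun_apply (ρ := ρ) (1 : U)
    simp only [Subgroup.coe_one, map_one] at this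
    simp [this]
  · intro x hx
    have : x.out ∉ U := fun hm => hx <| by
      rw [← QuotientGroup.out_eq' x, QuotientGroup.eq]
      simpa using hm
    simp [unitFun, this]

theorem convolution_unit {a : G → Module.End K W} (ha : a ∈ heckeModule U ρ) :
    convolution U a (unitFun U ρ) = a := by
  funext h
  have hF := summand_right_inv ha (unitFun_mem (U := U) (ρ := ρ)) h
  change ∑ᶠ x : G ⧸ U, a x.out * unitFun U ρ (x.out⁻¹ * h) = a h
  rw [finsum_eq_single _ (h : G ⧸ U)]
  · rw [out_eq (F := fun g => a g * unitFun U ρ (g⁻¹ * h)) hF h]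
    have := unitFun_apply (ρ := ρ) (1 : U)
    simp only [Subgroup.coe_one, map_one] at this
    simp [this]
  · intro x hx
    have : x.out⁻¹ * h ∉ U := fun hm => hx <| by
      rw [← QuotientGroup.out_eq' x, QuotientGroup.eq]
      simpa using hm
    simp [unitFun, this]

theorem convolution_assoc {a b c : G → Module.End K W} (ha : a ∈ heckeModule U ρ)
    (hb : b ∈ heckeModule U ρ) (hc : c ∈ heckeModule U ρ) :
    convolution U (convolution U a b) c = convolution U a (convolution U b c) := by
  funext h
  have hab := convolution_mem ha hb
  have hfa := finite_out ha
  have hfab := finite_out hab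
  have e1 : convolution U (convolution U a b) c h =
      ∑ᶠ x : G ⧸ U, ∑ᶠ y : G ⧸ U, a y.out * b (y.out⁻¹ * x.out) * c (x.out⁻¹ * h) :=
    finsum_congr fun x => finsum_mul' _ _ (finite_support ha _)
  have e2 : convolution U a (convolution U b c) h =
      ∑ᶠ y : G ⧸ U, ∑ᶠ x : G ⧸ U, a y.out * b (y.out⁻¹ * x.out) * c (x.out⁻¹ * h) := by
    refine finsum_congr fun y => ?_
    change a y.out * ∑ᶠ x : G ⧸ U, b x.out * c (x.out⁻¹ * (y.out⁻¹ * h)) = _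
    rw [mul_finsum' _ _ (finite_support hb _)]
    rw [← finsum_translate (U := U)
      (F := fun x => a y.out * b (y.out⁻¹ * x) * c (x⁻¹ * h)) ?_ y.out]
    · refine finsum_congr fun x => ?_
      simp [mul_assoc]
    · intro g u
      have := summand_right_inv hb hc (y.out⁻¹ * h) (y.out⁻¹ * g) u
      have k1 : (y.out⁻¹ * g)⁻¹ * (y.out⁻¹ * h) = g⁻¹ * h := by group
      have k2 : (y.out⁻¹ * g * (u : G))⁻¹ * (y.out⁻¹ * h) = (g * u)⁻¹ * h := by group
      rw [k1, k2, mul_assoc y.out⁻¹] at this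
      simp only [mul_assoc (a _), this]
  rw [e1, e2]
  -- both index sets may be cut down to finite ones
  set T : Set (G ⧸ U) := (fun p : (G ⧸ U) × (G ⧸ U) => ((p.1.out * p.2.out : G) : G ⧸ U)) ''
    ({y | a y.out ≠ 0} ×ˢ {z | b z.out ≠ 0}) with hT
  have hTf : T.Finite := (hfa.prod (finite_out hb)).image _
  have hz : ∀ x y : G ⧸ U, (x ∉ T ∨ a y.out = 0) →
      a y.out * b (y.out⁻¹ * x.out) * c (x.out⁻¹ * h) = 0 := by
    rintro x y (hx | hy)
    · by_contra hne
      have hay : a y.out ≠ 0 := fun h0 => hne (by simp [h0])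
      have hby : b (y.out⁻¹ * x.out) ≠ 0 := fun h0 => hne (by simp [h0])
      obtain ⟨u, hu⟩ := QuotientGroup.mk_out_eq_mul U (y.out⁻¹ * x.out)
      refine hx ⟨(y, ((y.out⁻¹ * x.out : G) : G ⧸ U)), ⟨hay, ?_⟩, ?_⟩
      · intro h0
        simp only at h0
        rw [hu, right_equivariant hb] at h0
        apply hby
        calc b (y.out⁻¹ * x.out) = b (y.out⁻¹ * x.out) * ρ u * ρ u⁻¹ := by
              rw [mul_assoc, ← map_mul]; simp
          _ = 0 := by rw [h0, zero_mul]
      · simp only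
        rw [hu]
        conv_rhs => rw [← QuotientGroup.out_eq' x]
        rw [QuotientGroup.eq]
        have : (y.out * (y.out⁻¹ * x.out * (u : G)))⁻¹ * x.out = (u : G)⁻¹ := by group
        rw [this]
        exact U.inv_mem u.2
    · simp [hy]
  have s1 : ∀ f : G ⧸ U → G ⧸ U → Module.End K W,
      (∀ x y, (x ∉ T ∨ a y.out = 0) → f x y = 0) →
      ∑ᶠ x, ∑ᶠ y, f x y = ∑ x ∈ hTf.toFinset, ∑ y ∈ hfa.toFinset, f x y := by
    intro f hf
    rw [finsum_eq_finsetSum_of_support_subset (s := hTf.toFinset)]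
    · refine Finset.sum_congr rfl fun x _ => ?_
      refine finsum_eq_finsetSum_of_support_subset _ fun y hy => ?_
      simp only [Set.Finite.coe_toFinset, Set.mem_ofPred_eq]
      exact fun h0 => hy (hf x y (Or.inr h0))
    · intro x hx
      simp only [Set.Finite.coe_toFinset]
      by_contra h0
      exact hx (finsum_eq_zero_of_forall_eq_zero fun y => hf x y (Or.inl h0))
  have s2 : ∀ f : G ⧸ U → G ⧸ U → Module.End K W,
      (∀ x y, (x ∉ T ∨ a y.out = 0) → f x y = 0) →
      ∑ᶠ y, ∑ᶠ x, f x y = ∑ y ∈ hfa.toFinset, ∑ x ∈ hTf.toFinset, f x y := by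
    intro f hf
    rw [finsum_eq_finsetSum_of_support_subset (s := hfa.toFinset)]
    · refine Finset.sum_congr rfl fun y _ => ?_
      refine finsum_eq_finsetSum_of_support_subset _ fun x hx => ?_
      simp only [Set.Finite.coe_toFinset]
      by_contra h0
      exact hx (hf x y (Or.inl h0))
    · intro y hy
      simp only [Set.Finite.coe_toFinset, Set.mem_ofPred_eq]
      exact fun h0 => hy (finsum_eq_zero_of_forall_eq_zero fun x => hf x y (Or.inr h0))
  rw [s1 _ hz, s2 _ hz, Finset.sum_comm]

noncomputable instance : Mul (HeckeAlgebra U ρ) :=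
  ⟨fun a b => ⟨convolution U a.1 b.1, convolution_mem a.2 b.2⟩⟩

noncomputable instance : One (HeckeAlgebra U ρ) :=
  ⟨⟨unitFun U ρ, unitFun_mem⟩⟩

theorem coe_mul (a b : HeckeAlgebra U ρ) :
    ((a * b : HeckeAlgebra U ρ) : G → Module.End K W) = convolution U a.1 b.1 := rfl

theorem coe_one : ((1 : HeckeAlgebra U ρ) : G → Module.End K W) = unitFun U ρ := rfl

theorem convolution_add {a b c : G → Module.End K W} (ha : a ∈ heckeModule U ρ) :
    convolution U a (b + c) = convolution U a b + convolution U a c := by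
  funext h
  refine Eq.trans (finsum_congr fun x => ?_)
    (finsum_add_distrib (finite_support ha _) (finite_support ha _))
  simp [← Module.End.mul_eq_comp, mul_add]

theorem add_convolution {a b c : G → Module.End K W} (ha : a ∈ heckeModule U ρ)
    (hb : b ∈ heckeModule U ρ) :
    convolution U (a + b) c = convolution U a c + convolution U b c := by
  funext h
  refine Eq.trans (finsum_congr fun x => ?_)
    (finsum_add_distrib (finite_support ha _) (finite_support hb _))
  simp [← Module.End.mul_eq_comp, add_mul]

/-- The ring structure of the Hecke algebra, with convolution as multiplication. -/
noncomputable instance : Ring (HeckeAlgebra U ρ) where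
  __ := (inferInstance : AddCommGroup (heckeModule U ρ))
  mul := (· * ·)
  one := 1
  left_distrib a _ _ := Subtype.ext (convolution_add a.2)
  right_distrib a b _ := Subtype.ext (add_convolution a.2 b.2)
  zero_mul b := Subtype.ext <| by
    funext h
    exact finsum_eq_zero_of_forall_eq_zero fun x => by simp
  mul_zero a := Subtype.ext <| by
    funext h
    exact finsum_eq_zero_of_forall_eq_zero fun x => by simp
  mul_assoc a b c := Subtype.ext (convolution_assoc a.2 b.2 c.2)
  one_mul a := Subtype.ext (unit_convolution a.2)
  mul_one a := Subtype.ext (convolution_unit a.2)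

theorem smul_convolution (r : K) {a b : G → Module.End K W} (ha : a ∈ heckeModule U ρ) :
    convolution U (r • a) b = r • convolution U a b := by
  funext h
  change _ = r • ∑ᶠ x : G ⧸ U, a x.out * b (x.out⁻¹ * h)
  rw [smul_finsum' _ (finite_support ha _)]
  exact finsum_congr fun x => by simp [← Module.End.mul_eq_comp]

theorem convolution_smul (r : K) {a b : G → Module.End K W} (ha : a ∈ heckeModule U ρ) :
    convolution U a (r • b) = r • convolution U a b := by
  funext h
  change _ = r • ∑ᶠ x : G ⧸ U, a x.out * b (x.out⁻¹ * h)
  rw [smul_finsum' _ (finite_support ha _)]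
  exact finsum_congr fun x => by simp [← Module.End.mul_eq_comp]

/-- The `K`-algebra structure of the Hecke algebra. -/
noncomputable instance : Algebra K (HeckeAlgebra U ρ) :=
  Algebra.ofModule (fun r a _ => Subtype.ext (smul_convolution r a.2))
    (fun r a _ => Subtype.ext (convolution_smul r a.2))

end Hecke

/-! ### Locally analytic representations and the derived action -/

section Analytic

variable {L : Type*} [NontriviallyNormedField L]
variable {F : Type*} [NormedAddCommGroup F] [NormedSpace L F]
variable {H : Type*} [TopologicalSpace H] (I : ModelWithCorners L F H)
variable {G : Type*} [Group G] [TopologicalSpace G] [ChartedSpace H G]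
variable {K : Type*} [NontriviallyNormedField K] [NormedAlgebra L K]
variable {E : Type*} [NormedAddCommGroup E] [NormedSpace K E] [NormedSpace L E]
  [IsScalarTower L K E]

/-- A representation of the Lie group `G` on `E` is locally `L`-analytic if all its orbit maps
`g ↦ ρ(g) v` are locally `L`-analytic functions (`ω` stands for analyticity). -/
def IsLocallyAnalytic (ρ : Representation K G E) : Prop :=
  ∀ v : E, ContMDiff I 𝓘(L, E) ω fun g : G => ρ g v

variable {I}

theorem mdifferentiableAt_orbit {ρ : Representation K G E} (hρ : IsLocallyAnalytic I ρ) (v : E) :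
    MDifferentiableAt I 𝓘(L, E) (fun g : G => ρ g v) 1 :=
  (hρ v).mdifferentiableAt (by simp)

/-- The derivative at `1` of the orbit map `g ↦ ρ(g) v` in the direction `X`. -/
noncomputable def orbitDerivative (ρ : Representation K G E) (X : GroupLieAlgebra I G) (v : E) : E :=
  mfderiv I 𝓘(L, E) (fun g : G => ρ g v) 1 X

theorem orbitDerivative_add {ρ : Representation K G E} (hρ : IsLocallyAnalytic I ρ)
    (X : GroupLieAlgebra I G) (v w : E) :
    orbitDerivative ρ X (v + w) = orbitDerivative ρ X v + orbitDerivative ρ X w := by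
  have h := ((mdifferentiableAt_orbit hρ v).hasMFDerivAt.add
    (mdifferentiableAt_orbit hρ w).hasMFDerivAt).mfderiv
  have e : (fun g : G => ρ g (v + w)) = (fun g : G => ρ g v) + fun g : G => ρ g w := by
    funext g
    simp
  unfold orbitDerivative
  rw [e, h]
  rfl

theorem orbitDerivative_smul {ρ : Representation K G E} (hρ : IsLocallyAnalytic I ρ)
    (X : GroupLieAlgebra I G) (c : K) (v : E) :
    orbitDerivative ρ X (c • v) = c • orbitDerivative ρ X v := by
  have h := ((c • ContinuousLinearMap.id L E).hasMFDerivAt.comp (1 : G)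
    (mdifferentiableAt_orbit hρ v).hasMFDerivAt).mfderiv
  have e : (fun g : G => ρ g (c • v)) =
      (c • ContinuousLinearMap.id L E : E →L[L] E) ∘ fun g : G => ρ g v := by
    funext g
    simp
  unfold orbitDerivative
  rw [e, h]
  rfl

/-- The derived action of the Lie algebra `𝔤 = T_1 G`: the element `X` sends `v` to the
derivative of the orbit map `g ↦ ρ(g) v` at `1` in the direction `X`. -/
noncomputable def derivedAction {ρ : Representation K G E} (hρ : IsLocallyAnalytic I ρ) :
    GroupLieAlgebra I G →ₗ[L] Module.End K E where
  toFun X :=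
    { toFun := orbitDerivative ρ X
      map_add' := orbitDerivative_add hρ X
      map_smul' := orbitDerivative_smul hρ X }
  map_add' X Y := by
    ext v
    exact map_add (mfderiv I 𝓘(L, E) (fun g : G => ρ g v) 1) X Y
  map_smul' c X := by
    ext v
    exact map_smul (mfderiv I 𝓘(L, E) (fun g : G => ρ g v) 1) c X

/-- The action of `K ⊗_L 𝔤` on `E` obtained from the derived action of `𝔤`:
`a ⊗ X` acts as `a` times the derived action of `X`. -/
noncomputable def extendedDerivedAction {ρ : Representation K G E}
    (hρ : IsLocallyAnalytic I ρ) :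
    K ⊗[L] GroupLieAlgebra I G →ₗ[K] Module.End K E :=
  LinearMap.liftBaseChange K (derivedAction hρ)

end Analytic

/-- Let `A` act `K`-linearly on the `K`-vector space `E` via `φ`. The `A`-module `E` is
absolutely irreducible if for every extension field `K'` of `K` the base change `K' ⊗_K E` is an
irreducible module over `K' ⊗_K A`: it is non-zero and its only subspaces stable under the action
are the trivial ones. -/
def IsAbsolutelyIrreducible.{u, v, w} {K : Type u} [Field K] {A : Type v} [AddCommGroup A]
    [Module K A] {E : Type w} [AddCommGroup E] [Module K E] (φ : A →ₗ[K] Module.End K E) : Prop :=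
  ∀ (K' : Type u) [Field K'] [Algebra K K'], Nontrivial (K' ⊗[K] E) ∧
    ∀ N : Submodule K' (K' ⊗[K] E),
      (∀ a : A, ∀ x ∈ N, (φ a).baseChange K' x ∈ N) → N = ⊥ ∨ N = ⊤

end BanachHecke

namespace BanachHecke

/-! ### Schur's lemma -/

section Schur

variable {K A E : Type*} [Field K] [AddCommGroup A] [Module K A] [AddCommGroup E] [Module K E]

/-! Multiplying by `ρ` respects convolution because `ρ` is a homomorphism on all of `G`, and it is
injective because each `ρ g` is invertible on the non-zero space `E`. The content is surjectivity.
Given `ψ` in the target and `g` in `G`, put `f = ψ(g) ρ(g)⁻¹`. Computing `ψ(xg)` by left and by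
right equivariance shows that `f` commutes with `ρ(x)` for `x` in the open subgroup `U ∩ gUg⁻¹`
(`eventually_commute`). The derived action only sees `ρ` near `1`, so differentiating orbit maps
makes `f` commute with `𝔤`, hence with `K ⊗ 𝔤` (`commute_extendedDerivedAction`). Schur's lemma in
its absolute form (`exists_eq_smul_one`) makes `f` a scalar `c(g)`, so `ψ = c · ρ`. Since `ρ(g) ≠
0`, the function `c` is unique and inherits bi-invariance and compact support from `ψ`
(`exists_twist_eq`). -/

theorem IsAbsolutelyIrreducible.nontrivial {φ : A →ₗ[K] Module.End K E}
    (hφ : IsAbsolutelyIrreducible φ) : Nontrivial E := by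
  have := (hφ K).1
  exact (TensorProduct.lid K E).symm.toEquiv.nontrivial

/-- Schur's lemma: an endomorphism of a finite dimensional absolutely irreducible module is a
scalar. -/
theorem IsAbsolutelyIrreducible.exists_eq_smul_one [FiniteDimensional K E]
    {φ : A →ₗ[K] Module.End K E} (hφ : IsAbsolutelyIrreducible φ) (f : Module.End K E)
    (hf : ∀ a, Commute (φ a) f) : ∃ c : K, f = c • 1 := by
  have hE := hφ.nontrivial
  -- Over the algebraic closure the base change of `f` has an eigenvalue; its eigenspace is non-zero
  -- and stable, hence everything.
  obtain ⟨hnt, hN⟩ := hφ (AlgebraicClosure K)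
  obtain ⟨c, hc⟩ := Module.End.exists_eigenvalue (f.baseChange (AlgebraicClosure K))
  have htop : Module.End.eigenspace (f.baseChange (AlgebraicClosure K)) c = ⊤ := by
    refine (hN _ fun a x hx => ?_).resolve_left hc
    rw [Module.End.mem_eigenspace_iff] at hx ⊢
    have h : f.baseChange (AlgebraicClosure K) ((φ a).baseChange (AlgebraicClosure K) x) =
        (φ a).baseChange (AlgebraicClosure K) (f.baseChange (AlgebraicClosure K) x) := by
      rw [← LinearMap.comp_apply, ← LinearMap.comp_apply, ← LinearMap.baseChange_comp,
        ← LinearMap.baseChange_comp, ← Module.End.mul_eq_comp, ← Module.End.mul_eq_comp,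
        (hf a).eq]
    rw [h, hx, map_smul]
  have hscalar (w : E) : (1 : AlgebraicClosure K) ⊗ₜ[K] f w = c ⊗ₜ[K] w := by
    have : (1 : AlgebraicClosure K) ⊗ₜ[K] w ∈
        Module.End.eigenspace (f.baseChange (AlgebraicClosure K)) c := htop ▸ Submodule.mem_top
    rw [Module.End.mem_eigenspace_iff] at this
    simpa [TensorProduct.smul_tmul'] using this
  -- The eigenvalue descends to `K`: a linear form `l` with `l v ≠ 0`, applied to `1 ⊗ f v = c ⊗ v`,
  -- gives `l (f v) = c * l v`.
  obtain ⟨v, hv⟩ := exists_ne (0 : E)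
  obtain ⟨l, hl⟩ := Module.Projective.exists_dual_ne_zero K hv
  have hc : c = algebraMap K (AlgebraicClosure K) (l (f v) / l v) := by
    have h := congrArg (TensorProduct.rid K (AlgebraicClosure K) ∘
      l.lTensor (AlgebraicClosure K)) (hscalar v)
    simp only [Function.comp_apply, LinearMap.lTensor_tmul, TensorProduct.rid_tmul,
      Algebra.smul_def, mul_one] at h
    have h0 : algebraMap K (AlgebraicClosure K) (l v) ≠ 0 := by simpa using hl
    rw [map_div₀, h, mul_div_cancel_left₀ _ h0]
  refine ⟨l (f v) / l v, LinearMap.ext fun w => ?_⟩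
  refine Module.FaithfullyFlat.tensorProduct_mk_injective (A := K) (B := AlgebraicClosure K) E ?_
  change (1 : AlgebraicClosure K) ⊗ₜ[K] f w = 1 ⊗ₜ[K] ((l (f v) / l v) • w)
  rw [hscalar, hc, TensorProduct.tmul_smul, TensorProduct.smul_tmul', Algebra.smul_def, mul_one]

end Schur

/-! ### Endomorphisms commuting with an open subgroup -/

section Analytic

variable {L : Type*} [NontriviallyNormedField L]
variable {F : Type*} [NormedAddCommGroup F] [NormedSpace L F]
variable {H : Type*} [TopologicalSpace H] {I : ModelWithCorners L F H}
variable {G : Type*} [Group G] [TopologicalSpace G] [ChartedSpace H G]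
variable {K : Type*} [NontriviallyNormedField K] [CompleteSpace K] [NormedAlgebra L K]
variable {E : Type*} [NormedAddCommGroup E] [NormedSpace K E] [FiniteDimensional K E]
  [NormedSpace L E] [IsScalarTower L K E]

/-- An endomorphism commuting with the group action near `1` commutes with the derived action. -/
theorem commute_derivedAction {ρ : Representation K G E} (hρ : IsLocallyAnalytic I ρ)
    (f : Module.End K E) (hf : ∀ᶠ g in nhds (1 : G), Commute (ρ g) f) (X : GroupLieAlgebra I G) :
    Commute (derivedAction hρ X) f := by
  ext v
  change orbitDerivative ρ X (f v) = f (orbitDerivative ρ X v)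
  -- Chain rule: `f` is continuous because `E` is finite dimensional over the complete field `K`,
  -- and it is its own derivative.
  have h := (((LinearMap.toContinuousLinearMap f).restrictScalars L).hasMFDerivAt.comp (1 : G)
    (mdifferentiableAt_orbit hρ v).hasMFDerivAt).mfderiv
  have e : (fun g : G => ρ g (f v)) =ᶠ[nhds 1]
      ((LinearMap.toContinuousLinearMap f).restrictScalars L) ∘ fun g : G => ρ g v :=
    hf.mono fun g hg => LinearMap.congr_fun hg.eq v
  unfold orbitDerivative
  rw [e.mfderiv_eq, h]
  rfl

/-- The elements commuting with `f` form a `K`-subspace, so pure tensors suffice. -/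
theorem commute_extendedDerivedAction {ρ : Representation K G E} (hρ : IsLocallyAnalytic I ρ)
    (f : Module.End K E) (hf : ∀ᶠ g in nhds (1 : G), Commute (ρ g) f)
    (a : K ⊗[L] GroupLieAlgebra I G) : Commute (extendedDerivedAction hρ a) f := by
  induction a with
  | zero => simp
  | add a b ha hb => rw [map_add]; exact ha.add_left hb
  | tmul k X => exact (commute_derivedAction hρ f hf X).smul_left k

end Analytic

/-! ### Twisting the Hecke algebra of the trivial representation -/

section Twist

variable {G : Type*} [Group G] [TopologicalSpace G]
variable {K : Type*} [Field K] {E : Type*} [AddCommGroup E] [Module K E]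

/-- The function `ψ · ρ`. -/
def twist (ρ : Representation K G E) (ψ : G → Module.End K K) (g : G) : Module.End K E :=
  ψ g 1 • ρ g

variable {U : Subgroup G} (ρ : Representation K G E)

theorem trivial_apply_mul {ψ : G → Module.End K K}
    (hψ : ψ ∈ heckeModule U (Representation.trivial K U K)) (u₁ u₂ : U) (g : G) :
    ψ (u₁ * g * u₂) = ψ g :=
  (hψ.2 u₁ u₂ g).trans (by ext; simp)

theorem twist_mem {ψ : G → Module.End K K}
    (hψ : ψ ∈ heckeModule U (Representation.trivial K U K)) :
    twist ρ ψ ∈ heckeModule U (ρ.comp U.subtype) := by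
  refine ⟨hψ.1.mono fun g hg h => hg (by simp [twist, h]), fun u₁ u₂ g => ?_⟩
  simp [twist, trivial_apply_mul hψ, LinearMap.smul_comp, LinearMap.comp_smul,
    Module.End.mul_eq_comp, LinearMap.comp_assoc]

theorem inv_apply_mul (g : G) : ρ g⁻¹ * ρ g = 1 := by
  rw [← map_mul, inv_mul_cancel, map_one]

theorem apply_ne_zero [Nontrivial E] (g : G) : ρ g ≠ 0 := fun h =>
  one_ne_zero (α := Module.End K E) <| by rw [← inv_apply_mul ρ g, h, mul_zero]

variable [IsTopologicalGroup G]

/-- For `ψ` in the Hecke algebra of `ρ`, the endomorphism `ψ(g) ρ(g)⁻¹` commutes with the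
action of the open subgroup `U ∩ g U g⁻¹`. -/
theorem eventually_commute (hU : IsOpen (U : Set G)) {ψ : G → Module.End K E}
    (hψ : ψ ∈ heckeModule U (ρ.comp U.subtype)) (g : G) :
    ∀ᶠ x in nhds (1 : G), Commute (ρ x) (ψ g * ρ g⁻¹) := by
  have hcont : Continuous fun x : G => g⁻¹ * x * g := by fun_prop
  have h1 : ∀ᶠ x in nhds (1 : G), x ∈ U := hU.mem_nhds U.one_mem
  have h2 : ∀ᶠ x in nhds (1 : G), g⁻¹ * x * g ∈ U :=
    (hU.preimage hcont).mem_nhds (by simp)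
  filter_upwards [h1, h2] with x hx hx'
  -- Two evaluations of `ψ` at the same point, since `x * g = g * (g⁻¹ * x * g)`.
  have e1 : ψ (x * g) = ρ x * ψ g := left_equivariant hψ ⟨x, hx⟩ g
  have e2 : ψ (g * (g⁻¹ * x * g)) = ψ g * ρ (g⁻¹ * x * g) := right_equivariant hψ ⟨_, hx'⟩ g
  rw [show g * (g⁻¹ * x * g) = x * g by group, e1] at e2
  change ρ x * (ψ g * ρ g⁻¹) = ψ g * ρ g⁻¹ * ρ x
  rw [← mul_assoc, e2, mul_assoc (ψ g), mul_assoc (ψ g), ← map_mul, ← map_mul,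
    show g⁻¹ * x * g * g⁻¹ = g⁻¹ * x by group]

/-- The scalars are determined by `ψ` because `ρ g ≠ 0`, so each property required of the preimage
can be checked after multiplying by `ρ`. -/
theorem exists_twist_eq [Nontrivial E] {ψ : G → Module.End K E}
    (hψ : ψ ∈ heckeModule U (ρ.comp U.subtype))
    (hs : ∀ g, ∃ c : K, ψ g * ρ g⁻¹ = c • 1) :
    ∃ χ ∈ heckeModule U (Representation.trivial K U K), twist ρ χ = ψ := by
  choose c hc using hs
  have hc' (g : G) : ψ g = c g • ρ g := by
    have := congrArg (· * ρ g) (hc g)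
    simpa [mul_assoc, inv_apply_mul] using this
  have hinj (g : G) {a b : K} (h : a • ρ g = b • ρ g) : a = b := by
    exact smul_left_injective K (apply_ne_zero ρ g) h
  refine ⟨fun g => c g • 1, ⟨hψ.1.mono fun g hg h => hg ?_, fun u₁ u₂ g => ?_⟩, ?_⟩
  · have : c g = 0 := hinj g (by rw [← hc', h, zero_smul])
    simp [this]
  · have h : c (u₁ * g * u₂) = c g := by
      refine hinj (u₁ * g * u₂) ?_
      rw [← hc', hψ.2, hc']
      simp [LinearMap.smul_comp, LinearMap.comp_smul, Module.End.mul_eq_comp,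
        LinearMap.comp_assoc]
    ext
    simp [h]
  · funext g
    simp [twist, hc']

theorem twist_injective [Nontrivial E] : Function.Injective (twist (G := G) ρ) := by
  intro a b h
  funext g
  ext
  exact smul_left_injective K (apply_ne_zero ρ g) (congrFun h g)

variable [IsCompactOpen U]

/-- The factorization `ρ(h) = ρ(x) ρ(x⁻¹h)` distributes `ρ(h)` over the two factors of each summand.
Both sums use the same coset representatives, so they agree term by term; membership of `a` is what
makes the sum finite. -/
theorem twist_convolution {a b : G → Module.End K K}
    (ha : a ∈ heckeModule U (Representation.trivial K U K)) :
    twist ρ (convolution U a b) = convolution U (twist ρ a) (twist ρ b) := by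
  funext h
  change (∑ᶠ x : G ⧸ U, a x.out * b (x.out⁻¹ * h)) 1 • ρ h = _
  have hfin := finite_support ha fun x : G ⧸ U => b (x.out⁻¹ * h)
  let m : Module.End K K →+ Module.End K E :=
    { toFun := fun f => f 1 • ρ h
      map_zero' := by simp
      map_add' := fun f f' => by simp [add_smul] }
  refine (m.map_finsum hfin).trans (finsum_congr fun x => ?_)
  -- A `K`-linear endomorphism of `K` is multiplication by its value at `1`, so composition becomes
  -- the product of values.
  have hmul : (a x.out * b (x.out⁻¹ * h)) 1 = a x.out 1 * b (x.out⁻¹ * h) 1 := by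
    rw [Module.End.mul_apply, ← mul_one (b _ 1), ← smul_eq_mul, map_smul, smul_eq_mul, mul_comm,
      smul_eq_mul, mul_one]
  have hρ : ρ h = ρ x.out * ρ (x.out⁻¹ * h) := by rw [← map_mul, mul_inv_cancel_left]
  change (a x.out * b (x.out⁻¹ * h)) 1 • ρ h =
    (a x.out 1 • ρ x.out) * (b (x.out⁻¹ * h) 1 • ρ (x.out⁻¹ * h))
  rw [hmul, hρ, smul_mul_smul_comm]

theorem twist_unitFun :
    twist ρ (unitFun U (Representation.trivial K U K)) = unitFun U (ρ.comp U.subtype) := by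
  funext g
  by_cases hg : g ∈ U <;> simp [twist, unitFun, hg]

/-- The algebra homomorphism `ψ ↦ ψ · ρ`. -/
noncomputable def twistHom :
    HeckeAlgebra U (Representation.trivial K U K) →ₐ[K] HeckeAlgebra U (ρ.comp U.subtype) :=
  AlgHom.ofLinearMap
    { toFun := fun ψ => ⟨twist ρ ψ.1, twist_mem ρ ψ.2⟩
      map_add' := fun a b => Subtype.ext <| by funext g; simp [twist, add_smul]
      map_smul' := fun c a => Subtype.ext <| by funext g; simp [twist, mul_smul] }
    (Subtype.ext (twist_unitFun ρ))
    (fun a _ => Subtype.ext (twist_convolution ρ a.2))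

end Twist

end BanachHecke

theorem lemma1p4 (p : ℕ) [Fact p.Prime]
    -- the fields `ℚ_p ⊆ L ⊆ K`
    {L : Type*} [NontriviallyNormedField L] [NormedAlgebra ℚ_[p] L] [FiniteDimensional ℚ_[p] L]
    {K : Type*} [NontriviallyNormedField K] [CompleteSpace K] [NormedAlgebra ℚ_[p] K]
    [NormedAlgebra L K] [IsScalarTower ℚ_[p] L K]
    -- the locally `L`-analytic group `G`, modelled on the finite dimensional space `F`
    {F : Type*} [NormedAddCommGroup F] [NormedSpace L F] [FiniteDimensional L F]
    {G : Type*} [Group G] [TopologicalSpace G] [IsTopologicalGroup G] [LocallyCompactSpace G]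
    [TotallyDisconnectedSpace G] [ChartedSpace F G] [LieGroup 𝓘(L, F) ω G]
    -- the compact open subgroup `U`
    (U : Subgroup G) [BanachHecke.IsCompactOpen U]
    -- the locally `L`-analytic representation `ρ` of `G` on `E`
    {E : Type*} [NormedAddCommGroup E] [NormedSpace K E] [FiniteDimensional K E]
    [NormedSpace L E] [IsScalarTower L K E]
    (ρ : Representation K G E) (hρ : BanachHecke.IsLocallyAnalytic 𝓘(L, F) ρ)
    (hirr : BanachHecke.IsAbsolutelyIrreducible (BanachHecke.extendedDerivedAction hρ)) :
    ∃ ι : BanachHecke.HeckeAlgebra U (Representation.trivial K U K) ≃ₐ[K]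
        BanachHecke.HeckeAlgebra U (ρ.comp U.subtype),
      ∀ (ψ : BanachHecke.HeckeAlgebra U (Representation.trivial K U K)) (g : G),
        (ι ψ : G → Module.End K E) g = (ψ : G → Module.End K K) g 1 • ρ g := by
  have := hirr.nontrivial
  refine ⟨AlgEquiv.ofBijective (BanachHecke.twistHom ρ) ⟨fun a b h => ?_, fun ψ => ?_⟩,
    fun ψ g => rfl⟩
  · exact Subtype.ext (BanachHecke.twist_injective ρ (congrArg Subtype.val h))
  · obtain ⟨χ, hχ, h⟩ := BanachHecke.exists_twist_eq ρ ψ.2 fun g =>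
      hirr.exists_eq_smul_one _ <| BanachHecke.commute_extendedDerivedAction hρ _ <|
        BanachHecke.eventually_commute ρ BanachHecke.IsCompactOpen.isOpen ψ.2 g
    exact ⟨⟨χ, hχ⟩, Subtype.ext h⟩
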